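/- For $a,b,c\in\mathbb{Q}$ let $h_{a,b,c}=\dfrac{1}{1-e_1+a e_2+b e_3+c e_4}$, where $e_k$ is the $k$-th elementary symmetric polynomial in $x,y,z,w$. In particular $$h_{2/3,0,0}(x,y,z,w)=\frac{1}{1-(x+y+z+w)+\frac23(xy+xz+xw+yz+yw+zw)}.$$ Let $s_n = 9^n\,[(xyzw)^n]\,h_{2/3,0,0}(x,y,z,w)$ for $n\ge 0$, where $[(xyzw)^n]$ denotes the coefficient of $(xyzw)^n$ in the Taylor expansion at the origin. Then $s_0,\dots,s_5$ are $1, 24, 1080, 58560, 3490200, 220739904$, and there is a sequence $(u_n)_{n\ge0}$ of rational numbers such that $s_n=\binom{2n}{n}u_n$ for all $n\ge0$ and the following hold. 1. For all $n\ge 0$, with the convention $u_{-1}=0$, $$3(n+1)^2u_{n+1}=4(28n^2+28n+9)u_n-64(4n-1)(4n+1)u_{n-1}.$$ 2. The series $y_0(z)=\sum_{n\ge0}u_nz^n$ converges for complex $z$ near $0$, and $y_0$ is the unique (as a germ at $0$) function $y$ that is analytic at $0$, satisfies $y(0)=1$, and solves near $0$ the differential equation corresponding to this recurrence, $$z(1-16z)(3-64z)\,y''+(3-224z+3072z^2)\,y'+(960z-36)\,y=0.$$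 3. For all complex $z$ in a neighbourhood of $0$ (with principal branches of the roots), $$y_0(z)=\frac{1}{(1-48z+12288z^3)^{1/4}}\;{}_2F_1\!\left(\tfrac1{12},\tfrac5{12};1;\frac{-1728z^2(3-64z)(1-16z)^6}{(1-48z+12288z^3)^3}\right),$$ $$y_0(z)=\frac{1}{\sqrt{1-24z}}\;{}_2F_1\!\left(\tfrac14,\tfrac34;1;\frac{-64z^2(3-64z)}{(1-24z)^2}\right).$$ 4. $u_n>0$ and $s_n>0$ for all $n\ge0$. -/

import Mathlib

open Filter Topology

/-- The denominator `1 - e₁ + a e₂ + b e₃ + c e₄` in four variables, where `e_k` is the `k`-th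
elementary symmetric polynomial. -/
noncomputable def symDenominator (a b c : ℚ) : MvPolynomial (Fin 4) ℚ :=
  1 - MvPolynomial.esymm (Fin 4) ℚ 1 + MvPolynomial.C a * MvPolynomial.esymm (Fin 4) ℚ 2
    + MvPolynomial.C b * MvPolynomial.esymm (Fin 4) ℚ 3
    + MvPolynomial.C c * MvPolynomial.esymm (Fin 4) ℚ 4

/-- The Taylor expansion at the origin of the rational function
`h_{a,b,c} = 1 / (1 - e₁ + a e₂ + b e₃ + c e₄)`: the inverse of the denominator in the ring of
formal power series in four variables. -/
noncomputable def hSeries (a b c : ℚ) : MvPowerSeries (Fin 4) ℚ :=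
  (symDenominator a b c : MvPowerSeries (Fin 4) ℚ)⁻¹

/-- The denominator has constant term `1`, so that the inverse above is a true inverse. -/
theorem constantCoeff_symDenominator (a b c : ℚ) :
    MvPowerSeries.constantCoeff (symDenominator a b c : MvPowerSeries (Fin 4) ℚ) = 1 := by
  have h : ∀ k, 0 < k → MvPolynomial.constantCoeff (MvPolynomial.esymm (Fin 4) ℚ k) = 0 := by
    intro k hk
    rw [MvPolynomial.esymm, map_sum]
    refine Finset.sum_eq_zero fun s hs => ?_
    rw [Finset.mem_powersetCard] at hs
    rw [map_prod]
    obtain ⟨i, hi⟩ := Finset.card_pos.mp (hs.2.symm ▸ hk)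
    exact Finset.prod_eq_zero hi (MvPolynomial.constantCoeff_X _ i)
  rw [← MvPowerSeries.coeff_zero_eq_constantCoeff_apply, MvPolynomial.coeff_coe,
    ← MvPolynomial.constantCoeff_eq]
  simp [symDenominator, h]

theorem symDenominator_mul_hSeries (a b c : ℚ) :
    (symDenominator a b c : MvPowerSeries (Fin 4) ℚ) * hSeries a b c = 1 := by
  refine MvPowerSeries.mul_inv_cancel _ ?_
  rw [constantCoeff_symDenominator]
  exact one_ne_zero

/-- The scaled diagonal coefficient `s_n = 9ⁿ [(xyzw)ⁿ] h_{2/3,0,0}(x,y,z,w)`. -/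
noncomputable def scaledDiag (n : ℕ) : ℚ :=
  9 ^ n * MvPowerSeries.coeff (Finsupp.equivFunOnFinite.symm fun _ : Fin 4 => n)
    (hSeries (2 / 3) 0 0)

/-- Near `0`, the function `y` satisfies the linear differential equation
`z (1 - 16 z) (3 - 64 z) y'' + (3 - 224 z + 3072 z²) y' + (960 z - 36) y = 0`.
With `θ = z d/dz` this is
`3 θ² y = 4 z (28 θ² + 28 θ + 9) y - 64 z² (4 θ + 3) (4 θ + 5) y`, divided by `z`. -/
def SolvesDiagODE (y : ℂ → ℂ) : Prop :=
  ∀ᶠ z in 𝓝 (0 : ℂ),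
    z * (1 - 16 * z) * (3 - 64 * z) * deriv (deriv y) z
      + (3 - 224 * z + 3072 * z ^ 2) * deriv y z + (960 * z - 36) * y z = 0

/-! The key is that `1 - e₁ + (2/3) e₂` is a 2 × 2 determinant `det (1 - M)`, where `M = ∑ x_j P_j`
and `P_j` is the column `(α_j, β_j)` times the row `(1, l_j)`. The `P_j` have rank one, trace one
and `tr (P_i P_j) = 1/3` for `i ≠ j`: four equiangular lines in `ℂ²`, the vertices of a regular
tetrahedron on the Riemann sphere. Hence `tr M = e₁`, and each `x_i x_j` has coefficient `1 - 1/3`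
in `det M` (`tetra_det`).

By MacMahon's master theorem (`coeff_inv_det_eq_coeff_symTrace`), the degree `4n` part of the
expansion is the trace of the symmetric power `Sym^{4n} M`. Since the `P_j` have rank one, the
diagonal coefficient of each diagonal entry factors into one coefficient of `∏ (1 + l_j Y)^n` and
one of `∏ (α_j + β_j X)^n` (`coeff_diagExp_mixedCoeff`). Tetrahedral symmetry turns these products
into `(1 + Y³)^n` and `((1 + 8 X³)/27)^n`, so only the exponents `3k` survive. What remains is a
single sum of positive terms, `scaledDiag_eq`, which gives positivity.

Creative telescoping yields the recurrence `diagQuot_rec`; termwise it becomes the differential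
equation. The indicial polynomial at `0` is `3 s²`, so an analytic solution is determined by its
value at `0`. Both hypergeometric formulas follow by checking that their right-hand sides are
analytic solutions with value `1` (`solvesDiagODE_pullback`). -/

/-! ### The single sum and its recurrence by creative telescoping. -/

/-- The summand of the single-sum formula for `u_n`. -/
noncomputable def diagTerm (n k : ℕ) : ℚ :=
  8 ^ k * ((4 * n - 3 * k).factorial : ℚ) * ((3 * k).factorial : ℚ) /
    (3 ^ n * (k.factorial : ℚ) ^ 2 * ((n - k).factorial : ℚ) ^ 2 * ((2 * n).factorial : ℚ))

/-- The sequence `u_n` with `s_n = C(2n, n) u_n`. -/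
noncomputable def diagQuot (n : ℕ) : ℚ := ∑ k ∈ Finset.range (n + 1), diagTerm n k

/-- The polynomial part of the telescoping certificate for `diagTerm`. -/
noncomputable def certPoly (n k : ℚ) : ℚ :=
  (6240 + 23552 * n + 36088 * n ^ 2 + 28712 * n ^ 3 + 12496 * n ^ 4 + 2816 * n ^ 5
      + 256 * n ^ 6) / 3
    - (10008 + 30728 * n + 36966 * n ^ 2 + 21764 * n ^ 3 + 6264 * n ^ 4 + 704 * n ^ 5) / 3 * k
    + (1916 + 4532 * n + 3963 * n ^ 2 + 1520 * n ^ 3 + 216 * n ^ 4) * k ^ 2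
    - (456 + 760 * n + 418 * n ^ 2 + 76 * n ^ 3) * k ^ 3
    + (36 + 36 * n + 9 * n ^ 2) * k ^ 4

/-- The telescoping certificate for `diagTerm`. -/
noncomputable def certTerm (n k : ℕ) : ℚ :=
  k * certPoly n k * 8 ^ k * ((4 * n + 3 - 3 * k).factorial : ℚ) * ((3 * k).factorial : ℚ) /
    ((k.factorial : ℚ) ^ 2 * ((n + 2 - k).factorial : ℚ) ^ 2 * 3 ^ n
      * ((2 * n + 4).factorial : ℚ))

/-- Zeilberger's method: once the common factorials are divided out, this is an identity of rational
functions in `k` and `m`. Writing the outer index as `k + m` with `m : ℕ` restricts it to `k ≤ n`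
and removes every truncated subtraction. -/
theorem diagTerm_telescope (k m : ℕ) :
    3 * (((k + m : ℕ) : ℚ) + 2) ^ 2 * diagTerm (k + m + 2) k
      - 4 * (28 * (((k + m : ℕ) : ℚ) + 1) ^ 2 + 28 * (((k + m : ℕ) : ℚ) + 1) + 9)
        * diagTerm (k + m + 1) k
      + 64 * (4 * ((k + m : ℕ) : ℚ) + 3) * (4 * ((k + m : ℕ) : ℚ) + 5) * diagTerm (k + m) k
      = certTerm (k + m) (k + 1) - certTerm (k + m) k := by
  unfold diagTerm certTerm certPoly
  rw [show 4 * (k + m + 2) - 3 * k = k + 4 * m + 8 by omega,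
    show 4 * (k + m + 1) - 3 * k = k + 4 * m + 4 by omega,
    show 4 * (k + m) - 3 * k = k + 4 * m by omega,
    show k + m + 2 - k = m + 2 by omega, show k + m + 1 - k = m + 1 by omega,
    show k + m - k = m by omega, show 4 * (k + m) + 3 - 3 * (k + 1) = k + 4 * m by omega,
    show 4 * (k + m) + 3 - 3 * k = k + 4 * m + 3 by omega,
    show k + m + 2 - (k + 1) = m + 1 by omega,
    show 2 * (k + m + 2) = 2 * (k + m) + 4 by ring,
    show 2 * (k + m + 1) = 2 * (k + m) + 2 by ring,
    show 3 * (k + 1) = 3 * k + 3 by ring]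
  have h1 : (((k + 4 * m).factorial : ℕ) : ℚ) ≠ 0 := by positivity
  have h2 : (((3 * k).factorial : ℕ) : ℚ) ≠ 0 := by positivity
  have h3 : (((2 * (k + m)).factorial : ℕ) : ℚ) ≠ 0 := by positivity
  have h4 : ((m.factorial : ℕ) : ℚ) ≠ 0 := by positivity
  have h5 : ((k.factorial : ℕ) : ℚ) ≠ 0 := by positivity
  have e1 : (2 * ((k : ℚ) + m) + 1) ≠ 0 := by positivity
  have e2 : (2 * ((k : ℚ) + m) + 1 + 1) ≠ 0 := by positivity
  have e3 : (2 * ((k : ℚ) + m) + 1 + 1 + 1) ≠ 0 := by positivity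
  have e4 : (2 * ((k : ℚ) + m) + 1 + 1 + 1 + 1) ≠ 0 := by positivity
  have e5 : (m : ℚ) + 1 ≠ 0 := by positivity
  have e6 : (m : ℚ) + 1 + 1 ≠ 0 := by positivity
  have e7 : (k : ℚ) + 1 ≠ 0 := by positivity
  simp only [Nat.factorial_succ, pow_succ, pow_zero, one_mul]
  push_cast
  generalize (((k + 4 * m).factorial : ℕ) : ℚ) = A at *
  generalize (((3 * k).factorial : ℕ) : ℚ) = B at *
  generalize (((2 * (k + m)).factorial : ℕ) : ℚ) = C at *
  generalize ((m.factorial : ℕ) : ℚ) = M at *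
  generalize ((k.factorial : ℕ) : ℚ) = K at *
  field_simp
  ring

/-- The telescoping stops at `k = n`, while the sums for `n + 1` and `n + 2` run further; the excess
terms cancel the last value of the certificate. -/
theorem certTerm_boundary (n : ℕ) :
    3 * ((n : ℚ) + 2) ^ 2 * (diagTerm (n + 2) (n + 1) + diagTerm (n + 2) (n + 2))
      - 4 * (28 * ((n : ℚ) + 1) ^ 2 + 28 * ((n : ℚ) + 1) + 9) * diagTerm (n + 1) (n + 1)
      + certTerm n (n + 1) = 0 := by
  unfold diagTerm certTerm certPoly
  rw [show 4 * (n + 2) - 3 * (n + 1) = n + 5 by omega,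
    show 4 * (n + 2) - 3 * (n + 2) = n + 2 by omega,
    show 4 * (n + 1) - 3 * (n + 1) = n + 1 by omega,
    show n + 2 - (n + 1) = 1 by omega, show n + 2 - (n + 2) = 0 by omega,
    show n + 1 - (n + 1) = 0 by omega, show 4 * n + 3 - 3 * (n + 1) = n by omega,
    show 2 * (n + 2) = 2 * n + 4 by ring, show 2 * (n + 1) = 2 * n + 2 by ring,
    show 3 * (n + 1) = 3 * n + 3 by ring, show 3 * (n + 2) = 3 * n + 6 by ring]
  have h2 : (((3 * n).factorial : ℕ) : ℚ) ≠ 0 := by positivity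
  have h3 : (((2 * n).factorial : ℕ) : ℚ) ≠ 0 := by positivity
  have h4 : ((n.factorial : ℕ) : ℚ) ≠ 0 := by positivity
  have e1 : (2 * (n : ℚ) + 1) ≠ 0 := by positivity
  have e2 : (2 * (n : ℚ) + 1 + 1) ≠ 0 := by positivity
  have e3 : (2 * (n : ℚ) + 1 + 1 + 1) ≠ 0 := by positivity
  have e4 : (2 * (n : ℚ) + 1 + 1 + 1 + 1) ≠ 0 := by positivity
  have e5 : (n : ℚ) + 1 ≠ 0 := by positivity
  have e6 : (n : ℚ) + 1 + 1 ≠ 0 := by positivity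
  simp only [Nat.factorial_succ, Nat.factorial_zero, pow_succ, pow_zero, one_mul]
  push_cast
  generalize (((3 * n).factorial : ℕ) : ℚ) = B at *
  generalize (((2 * n).factorial : ℕ) : ℚ) = C at *
  generalize ((n.factorial : ℕ) : ℚ) = K at *
  field_simp
  ring

theorem diagQuot_rec (n : ℕ) :
    3 * ((n : ℚ) + 2) ^ 2 * diagQuot (n + 2)
      - 4 * (28 * ((n : ℚ) + 1) ^ 2 + 28 * ((n : ℚ) + 1) + 9) * diagQuot (n + 1)
      + 64 * (4 * (n : ℚ) + 3) * (4 * (n : ℚ) + 5) * diagQuot n = 0 := by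
  have hsum : ∑ k ∈ Finset.range (n + 1),
      (3 * ((n : ℚ) + 2) ^ 2 * diagTerm (n + 2) k
      - 4 * (28 * ((n : ℚ) + 1) ^ 2 + 28 * ((n : ℚ) + 1) + 9) * diagTerm (n + 1) k
      + 64 * (4 * (n : ℚ) + 3) * (4 * (n : ℚ) + 5) * diagTerm n k)
      = certTerm n (n + 1) - certTerm n 0 := by
    rw [← Finset.sum_range_sub]
    refine Finset.sum_congr rfl fun k hk => ?_
    obtain ⟨m, rfl⟩ := Nat.exists_eq_add_of_le (Finset.mem_range_succ_iff.mp hk)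
    exact diagTerm_telescope k m
  have h0 : certTerm n 0 = 0 := by simp [certTerm]
  rw [Finset.sum_add_distrib, Finset.sum_sub_distrib, ← Finset.mul_sum, ← Finset.mul_sum,
    ← Finset.mul_sum, h0] at hsum
  have hb := certTerm_boundary n
  unfold diagQuot
  rw [Finset.sum_range_succ _ (n + 2), Finset.sum_range_succ _ (n + 1),
    Finset.sum_range_succ (diagTerm (n + 1)) (n + 1)]
  linear_combination hsum + hb

theorem diagQuot_pos (n : ℕ) : 0 < diagQuot n :=
  Finset.sum_pos (fun k _ => by unfold diagTerm; positivity) ⟨0, by simp⟩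

theorem diagQuot_values :
    diagQuot 0 = 1 ∧ diagQuot 1 = 12 ∧ diagQuot 2 = 180 ∧ diagQuot 3 = 2928 ∧
      diagQuot 4 = 49860 ∧ diagQuot 5 = 875952 := by
  refine ⟨?_, ?_, ?_, ?_, ?_, ?_⟩ <;>
    norm_num [diagQuot, diagTerm, Finset.sum_range_succ, Nat.factorial]

/-! ### Traces of symmetric powers and the 2 × 2 master theorem. -/

section MacMahon

variable {R : Type*} [CommRing R]

/-- The coefficient of `Y ^ b` in `(p + q Y) ^ a * (r + t Y) ^ b`, as a function of `p`, `t` and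
`c = q r`. -/
def mixedCoeff (p t c : R) (a b : ℕ) : R :=
  ∑ i ∈ Finset.range (a + 1),
    ((a.choose i : R) * p ^ (a - i)) * ((b.choose i : R) * t ^ (b - i)) * c ^ i

theorem choose_mul_pow_succ (p : R) (a i : ℕ) :
    ((a + 1).choose (i + 1) : R) * p ^ (a + 1 - (i + 1))
      = p * ((a.choose (i + 1) : R) * p ^ (a - (i + 1))) + (a.choose i : R) * p ^ (a - i) := by
  rw [Nat.choose_succ_succ, Nat.add_sub_add_right]
  rcases Nat.lt_or_ge i a with h | h
  · obtain ⟨m, rfl⟩ := Nat.exists_eq_add_of_le (Nat.succ_le_of_lt h)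
    rw [show i.succ + m - i = m + 1 by omega, show i.succ + m - (i + 1) = m by omega]
    push_cast
    ring
  · rw [Nat.choose_eq_zero_of_lt (Nat.lt_succ_of_le h)]
    simp

/-- Equivalently, the generating function in `X^a Z^b` is `1 / (1 - pX - tZ + (pt - c)XZ)`. Summed
along antidiagonals, this gives the characteristic recurrence for `symTrace`. -/
theorem mixedCoeff_succ_succ (p t c : R) (a b : ℕ) :
    mixedCoeff p t c (a + 1) (b + 1)
      = p * mixedCoeff p t c a (b + 1) + t * mixedCoeff p t c (a + 1) b
        - (p * t - c) * mixedCoeff p t c a b := by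
  have ext : ∀ b, mixedCoeff p t c a b = ∑ i ∈ Finset.range (a + 2),
      ((a.choose i : R) * p ^ (a - i)) * ((b.choose i : R) * t ^ (b - i)) * c ^ i := by
    intro b
    rw [Finset.sum_range_succ, Nat.choose_succ_self]
    simp [mixedCoeff]
  -- By Pascal's rule each difference is the same factor with index `i - 1`, so the product of the
  -- two differences reproduces the sum shifted by one, at the cost of one factor `c`.
  have key : ∑ i ∈ Finset.range (a + 2),
      (((a + 1).choose i : R) * p ^ (a + 1 - i) - p * ((a.choose i : R) * p ^ (a - i)))
        * (((b + 1).choose i : R) * t ^ (b + 1 - i) - t * ((b.choose i : R) * t ^ (b - i))) * c ^ i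
      = c * mixedCoeff p t c a b := by
    rw [Finset.sum_range_succ', mixedCoeff, Finset.mul_sum]
    simp only [choose_mul_pow_succ]
    simp only [Nat.choose_zero_right, Nat.cast_one, one_mul, Nat.sub_zero, pow_succ]
    rw [show (p ^ a * p - p * p ^ a) = 0 by ring]
    simp only [zero_mul, add_zero]
    exact Finset.sum_congr rfl fun i _ => by ring
  have e0 := ext b
  have e1 := ext (b + 1)
  rw [sub_mul, ← key, e0, e1, mixedCoeff, mixedCoeff]
  simp only [Finset.mul_sum]
  rw [← Finset.sum_add_distrib, ← sub_eq_zero]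
  simp only [← Finset.sum_sub_distrib]
  refine Finset.sum_eq_zero fun i _ => ?_
  ring

theorem mixedCoeff_zero_right (p t c : R) (a : ℕ) : mixedCoeff p t c a 0 = p ^ a := by
  rw [mixedCoeff, Finset.sum_range_succ']
  simp

theorem mixedCoeff_zero_left (p t c : R) (b : ℕ) : mixedCoeff p t c 0 b = t ^ b := by
  simp [mixedCoeff]

/-- The trace of the `N`-th symmetric power of a `2 × 2` matrix with diagonal `p, t` and product
of the off-diagonal entries `c`. -/
def symTrace (p t c : R) (N : ℕ) : R :=
  ∑ x ∈ Finset.HasAntidiagonal.antidiagonal N, mixedCoeff p t c x.1 x.2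

theorem symTrace_zero (p t c : R) : symTrace p t c 0 = 1 := by
  simp [symTrace, mixedCoeff]

theorem symTrace_one (p t c : R) : symTrace p t c 1 = p + t := by
  simp [symTrace, Finset.Nat.antidiagonal_succ, mixedCoeff_zero_left, mixedCoeff_zero_right,
    add_comm]

theorem symTrace_add_two (p t c : R) (N : ℕ) :
    symTrace p t c (N + 2)
      = (p + t) * symTrace p t c (N + 1) - (p * t - c) * symTrace p t c N := by
  have h1 : symTrace p t c (N + 1)
      = p ^ (N + 1) + ∑ x ∈ Finset.HasAntidiagonal.antidiagonal N, mixedCoeff p t c x.1 (x.2 + 1) := by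
    rw [symTrace, Finset.Nat.sum_antidiagonal_succ', mixedCoeff_zero_right]
  have h2 : symTrace p t c (N + 1)
      = t ^ (N + 1) + ∑ x ∈ Finset.HasAntidiagonal.antidiagonal N, mixedCoeff p t c (x.1 + 1) x.2 := by
    rw [symTrace, Finset.Nat.sum_antidiagonal_succ, mixedCoeff_zero_left]
  have h3 : symTrace p t c (N + 2) = t ^ (N + 2) + p ^ (N + 2)
      + ∑ x ∈ Finset.HasAntidiagonal.antidiagonal N, mixedCoeff p t c (x.1 + 1) (x.2 + 1) := by
    rw [symTrace, Finset.Nat.sum_antidiagonal_succ, Finset.Nat.sum_antidiagonal_succ',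
      mixedCoeff_zero_left, mixedCoeff_zero_right]
    ring
  simp only [mixedCoeff_succ_succ, Finset.sum_sub_distrib, Finset.sum_add_distrib,
    ← Finset.mul_sum] at h3
  have h4 : ∑ x ∈ Finset.HasAntidiagonal.antidiagonal N, mixedCoeff p t c x.1 x.2
      = symTrace p t c N := rfl
  rw [h3, h4]
  linear_combination (-p) * h1 - t * h2

theorem mul_sum_symTrace (p t c : R) (K : ℕ) :
    (1 - (p + t) + (p * t - c)) * ∑ N ∈ Finset.range (K + 1), symTrace p t c N
      = 1 - (symTrace p t c (K + 1) - (p * t - c) * symTrace p t c K) := by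
  induction K with
  | zero => simp [symTrace_zero, symTrace_one]; ring
  | succ K ih =>
    rw [Finset.sum_range_succ, mul_add, ih, symTrace_add_two]
    ring

theorem isHomogeneous_mixedCoeff {σ : Type*} {p t c : MvPolynomial σ R}
    (hp : p.IsHomogeneous 1) (ht : t.IsHomogeneous 1) (hc : c.IsHomogeneous 2) (a b : ℕ) :
    (mixedCoeff p t c a b).IsHomogeneous (a + b) := by
  refine MvPolynomial.IsHomogeneous.sum _ _ _ fun i hi => ?_
  have hi' := Finset.mem_range_succ_iff.mp hi
  rcases Nat.lt_or_ge b i with h | h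
  · rw [Nat.choose_eq_zero_of_lt h]
    simpa using MvPolynomial.isHomogeneous_zero σ R (a + b)
  · have hn : ∀ m : ℕ, ((m : MvPolynomial σ R)).IsHomogeneous 0 := fun m => by
      rw [← map_natCast (MvPolynomial.C : R →+* MvPolynomial σ R)]
      exact MvPolynomial.isHomogeneous_C _ _
    have := (((hn (a.choose i)).mul (hp.pow (a - i))).mul
      ((hn (b.choose i)).mul (ht.pow (b - i)))).mul (hc.pow i)
    convert this using 1
    omega

theorem isHomogeneous_symTrace {σ : Type*} {p t c : MvPolynomial σ R}
    (hp : p.IsHomogeneous 1) (ht : t.IsHomogeneous 1) (hc : c.IsHomogeneous 2) (N : ℕ) :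
    (symTrace p t c N).IsHomogeneous N := by
  refine MvPolynomial.IsHomogeneous.sum _ _ _ fun x hx => ?_
  rw [← Finset.HasAntidiagonal.mem_antidiagonal.mp hx]
  exact isHomogeneous_mixedCoeff hp ht hc _ _

/-- The `2 × 2` case of MacMahon's master theorem: the coefficients of `1 / det (1 - M)`. -/
theorem coeff_inv_det_eq_coeff_symTrace {σ : Type*} {p t c : MvPolynomial σ R}
    (hp : p.IsHomogeneous 1) (ht : t.IsHomogeneous 1) (hc : c.IsHomogeneous 2)
    {h : MvPowerSeries σ R}
    (hh : ((1 - (p + t) + (p * t - c) : MvPolynomial σ R) : MvPowerSeries σ R) * h = 1)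
    (d : σ →₀ ℕ) :
    MvPowerSeries.coeff d h = MvPolynomial.coeff d (symTrace p t c d.degree) := by
  classical
  set K := d.degree with hK
  set P := ∑ N ∈ Finset.range (K + 1), symTrace p t c N with hP
  set E := symTrace p t c (K + 1) - (p * t - c) * symTrace p t c K with hE
  have hom := isHomogeneous_symTrace hp ht hc
  have hD : ((1 - (p + t) + (p * t - c) : MvPolynomial σ R) : MvPowerSeries σ R)
      * (P : MvPowerSeries σ R) = 1 - (E : MvPowerSeries σ R) := by
    rw [← MvPolynomial.coe_mul, hP, mul_sum_symTrace, ← hE]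
    exact (MvPolynomial.coeToMvPowerSeries.ringHom (σ := σ) (R := R)).map_sub 1 E |>.trans
      (by rw [map_one]; rfl)
  -- The inverse `h` differs from the truncated sum `P` by a multiple of `E`, whose terms have
  -- degree at least `K + 1`; hence they agree at `d`.
  have hsolve : h = P + h * E := by
    linear_combination (P : MvPowerSeries σ R) * hh - h * hD
  have hE0 : ∀ e ≤ d, MvPolynomial.coeff e E = 0 := by
    intro e he
    have hle : e.degree ≤ K := Finsupp.degree_mono he
    rw [hE, MvPolynomial.coeff_sub, (hom (K + 1)).coeff_eq_zero (by omega),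
      (((hp.mul ht).sub hc).mul (hom K)).coeff_eq_zero (by omega), sub_zero]
  have h0 : MvPowerSeries.coeff d (h * (E : MvPowerSeries σ R)) = 0 := by
    rw [MvPowerSeries.coeff_mul]
    refine Finset.sum_eq_zero fun x hx => ?_
    rw [MvPolynomial.coeff_coe, hE0 x.2 (by
      rw [← Finset.HasAntidiagonal.mem_antidiagonal.mp hx]; exact le_add_self), mul_zero]
  rw [hsolve, map_add, h0, add_zero, MvPolynomial.coeff_coe, hP, MvPolynomial.coeff_sum,
    Finset.sum_range_succ, Finset.sum_eq_zero, zero_add]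
  intro N hN
  rw [(hom N).coeff_eq_zero]
  have := Finset.mem_range.mp hN
  omega

end MacMahon

/-! ### Diagonal coefficients of products of linear forms. -/

section DiagonalExtraction

variable {R : Type*} [CommRing R]

/-- The linear form with coefficients `w`. -/
noncomputable def linForm (w : Fin 4 → R) : MvPolynomial (Fin 4) R :=
  ∑ i, w i • MvPolynomial.X i

/-- The exponent of `(xyzw)ⁿ`. -/
noncomputable def diagExp (n : ℕ) : Fin 4 →₀ ℕ := Finsupp.equivFunOnFinite.symm fun _ => n

/-- The multinomial theorem, cleared of denominators so that it holds over any commutative ring. It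
is later used over polynomial rings, where auxiliary variables act as scalars. -/
theorem coeff_diagExp_linForm_pow (w : Fin 4 → R) (n : ℕ) :
    (n.factorial : R) ^ 4 * MvPolynomial.coeff (diagExp n) (linForm w ^ (4 * n))
      = ((4 * n).factorial : R) * ∏ j, w j ^ n := by
  have hs : (diagExp n).sum (fun _ m => m) = 4 * n := by
    rw [Finsupp.sum_fintype _ _ fun _ => rfl]
    simp [diagExp]
  rw [linForm, MvPolynomial.coeff_linearCombination_X_pow_of_fintype, if_pos hs,
    Finsupp.multinomial_eq_of_support_subset (Finset.subset_univ _),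
    Finsupp.prod_fintype _ _ fun _ => pow_zero _]
  have h := Nat.multinomial_spec (Finset.univ : Finset (Fin 4)) (diagExp n)
  have h' : ((n.factorial : R)) ^ 4 * (Nat.multinomial Finset.univ (diagExp n) : R)
      = ((4 * n).factorial : R) := by
    have e : ∀ i, diagExp n i = n := fun i => rfl
    simp only [e, Finset.prod_const, Finset.sum_const, Finset.card_univ, Fintype.card_fin,
      smul_eq_mul] at h
    rw [← h]
    push_cast
    rfl
  rw [← mul_assoc, h']
  rfl

/-- Polynomials over multivariate polynomials, as multivariate polynomials over polynomials. -/
noncomputable def swapPoly (σ : Type*) (R : Type*) [CommRing R] :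
    Polynomial (MvPolynomial σ R) →+* MvPolynomial σ (Polynomial R) :=
  Polynomial.eval₂RingHom (MvPolynomial.map Polynomial.C) (MvPolynomial.C Polynomial.X)

theorem coeff_coeff_swapPoly {σ : Type*} (f : Polynomial (MvPolynomial σ R)) (d : σ →₀ ℕ) (b : ℕ) :
    (MvPolynomial.coeff d (swapPoly σ R f)).coeff b = MvPolynomial.coeff d (f.coeff b) := by
  induction f using Polynomial.induction_on' with
  | add f g hf hg => simp [hf, hg]
  | monomial n a =>
    rw [swapPoly, Polynomial.coe_eval₂RingHom, Polynomial.eval₂_monomial, ← map_pow,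
      mul_comm,
      MvPolynomial.coeff_C_mul, MvPolynomial.coeff_map, mul_comm, Polynomial.coeff_C_mul_X_pow,
      Polynomial.coeff_monomial]
    by_cases h : b = n
    · simp [h]
    · simp [h, Ne.symm h]

theorem swapPoly_linForm (α β : Fin 4 → R) :
    swapPoly (Fin 4) R (Polynomial.C (linForm α) + Polynomial.X * Polynomial.C (linForm β))
      = linForm fun j => Polynomial.C (α j) + Polynomial.X * Polynomial.C (β j) := by
  simp only [swapPoly, linForm, map_add, map_mul, Polynomial.coe_eval₂RingHom, Polynomial.eval₂_C,
    Polynomial.eval₂_X, map_sum, MvPolynomial.smul_eq_C_mul, MvPolynomial.map_C,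
    MvPolynomial.map_X, Finset.mul_sum, ← Finset.sum_add_distrib]
  exact Finset.sum_congr rfl fun i _ => by ring

theorem coeff_linear_pow (p q : R) (a k : ℕ) :
    ((Polynomial.C p + Polynomial.X * Polynomial.C q) ^ a).coeff k
      = (a.choose k : R) * p ^ (a - k) * q ^ k := by
  rw [add_comm, add_pow, Polynomial.finsetSum_coeff]
  have e : ∀ m ∈ Finset.range (a + 1),
      ((Polynomial.X * Polynomial.C q) ^ m * Polynomial.C p ^ (a - m)
        * (a.choose m : Polynomial R)).coeff k
      = if k = m then (a.choose k : R) * p ^ (a - k) * q ^ k else 0 := by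
    intro m _
    rw [show (Polynomial.X * Polynomial.C q) ^ m * Polynomial.C p ^ (a - m)
        * (a.choose m : Polynomial R)
        = Polynomial.C ((a.choose m : R) * p ^ (a - m) * q ^ m) * Polynomial.X ^ m by
      simp only [map_mul, map_pow, map_natCast]; ring, Polynomial.coeff_C_mul_X_pow]
    split_ifs with h
    · rw [h]
    · rfl
  rw [Finset.sum_congr rfl e, Finset.sum_ite_eq]
  split_ifs with h
  · rfl
  · rw [Nat.choose_eq_zero_of_lt (by simpa using h)]
    simp

/-- Polarization: expand the power of the pencil `linForm α + X * linForm β` and compare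
coefficients of `X ^ b`. -/
theorem coeff_diagExp_linForm_pow_mul (α β : Fin 4 → R) {n a b : ℕ} (hab : a + b = 4 * n) :
    (n.factorial : R) ^ 4 * (((4 * n).choose b : R)
        * MvPolynomial.coeff (diagExp n) (linForm α ^ a * linForm β ^ b))
      = ((4 * n).factorial : R)
        * (∏ j, (Polynomial.C (α j) + Polynomial.X * Polynomial.C (β j)) ^ n).coeff b := by
  have h := congrArg (fun f => Polynomial.coeff f b) (coeff_diagExp_linForm_pow
    (fun j => Polynomial.C (α j) + Polynomial.X * Polynomial.C (β j)) n)
  rw [← swapPoly_linForm, ← map_pow] at h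
  rw [← map_natCast (Polynomial.C : R →+* _), ← map_natCast (Polynomial.C : R →+* _),
    ← map_pow (Polynomial.C : R →+* _), Polynomial.coeff_C_mul, Polynomial.coeff_C_mul,
    coeff_coeff_swapPoly, coeff_linear_pow, mul_assoc,
    ← map_natCast (MvPolynomial.C : R →+* _), MvPolynomial.coeff_C_mul,
    show 4 * n - b = a by omega] at h
  exact h

theorem coeff_linear_pow_mul_linear_pow (p q r t : R) (a b : ℕ) :
    ((Polynomial.C p + Polynomial.X * Polynomial.C q) ^ a
      * (Polynomial.C r + Polynomial.X * Polynomial.C t) ^ b).coeff b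
      = mixedCoeff p t (q * r) a b := by
  have ha : ∀ i ∈ Finset.range (a + b + 1), i ∉ Finset.range (a + 1) →
      ((a.choose i : R) * p ^ (a - i)) * ((b.choose i : R) * t ^ (b - i)) * (q * r) ^ i = 0 := by
    intro i _ hi
    rw [Nat.choose_eq_zero_of_lt (by simpa using hi)]
    simp
  have hb : ∀ i ∈ Finset.range (a + b + 1), i ∉ Finset.range (b + 1) →
      ((a.choose i : R) * p ^ (a - i)) * ((b.choose i : R) * t ^ (b - i)) * (q * r) ^ i = 0 := by
    intro i _ hi
    rw [Nat.choose_eq_zero_of_lt (by simpa using hi) (n := b)]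
    simp
  rw [mixedCoeff, Finset.sum_subset (Finset.range_mono (by omega)) ha,
    ← Finset.sum_subset (Finset.range_mono (by omega)) hb, Polynomial.coeff_mul,
    Finset.Nat.sum_antidiagonal_eq_sum_range_succ_mk]
  refine Finset.sum_congr rfl fun i hi => ?_
  have hi' := Finset.mem_range_succ_iff.mp hi
  simp only [coeff_linear_pow]
  rw [Nat.choose_symm hi', Nat.sub_sub_self hi']
  ring

/-- With `Y` adjoined to the scalars, `p + qY` and `r + tY` are linear forms with coefficients `α_j
(1 + l_j Y)` and `β_j (1 + l_j Y)`. The rank-one shape lets `1 + l_j Y` factor out of the polarized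
product, which separates `X` from `Y`. -/
theorem coeff_diagExp_mixedCoeff (α β l : Fin 4 → R) {n a b : ℕ} (hab : a + b = 4 * n) :
    (n.factorial : R) ^ 4 * (((4 * n).choose b : R)
        * MvPolynomial.coeff (diagExp n) (mixedCoeff (linForm α) (linForm fun j => β j * l j)
          (linForm (fun j => α j * l j) * linForm β) a b))
      = ((4 * n).factorial : R)
        * ((∏ j, (1 + Polynomial.X * Polynomial.C (l j)) ^ n).coeff b
        * (∏ j, (Polynomial.C (α j) + Polynomial.X * Polynomial.C (β j)) ^ n).coeff b) := by
  have h := coeff_diagExp_linForm_pow_mul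
    (fun j => Polynomial.C (α j) + Polynomial.X * Polynomial.C (α j * l j))
    (fun j => Polynomial.C (β j) + Polynomial.X * Polynomial.C (β j * l j)) hab
  rw [← swapPoly_linForm, ← swapPoly_linForm, ← map_pow, ← map_pow, ← map_mul] at h
  have e : ∏ j, (Polynomial.C (Polynomial.C (α j) + Polynomial.X * Polynomial.C (α j * l j))
        + Polynomial.X
          * Polynomial.C (Polynomial.C (β j) + Polynomial.X * Polynomial.C (β j * l j))) ^ n
      = Polynomial.C (∏ j, (1 + Polynomial.X * Polynomial.C (l j)) ^ n)
        * Polynomial.map Polynomial.C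
          (∏ j, (Polynomial.C (α j) + Polynomial.X * Polynomial.C (β j)) ^ n) := by
    simp only [map_prod, Polynomial.map_prod, ← Finset.prod_mul_distrib, map_pow,
      Polynomial.map_pow, ← mul_pow]
    refine Finset.prod_congr rfl fun j _ => ?_
    congr 1
    simp only [map_add, map_mul, map_one, Polynomial.map_add, Polynomial.map_mul,
      Polynomial.map_C, Polynomial.map_X]
    ring
  rw [e, Polynomial.coeff_C_mul, Polynomial.coeff_map] at h
  have h' := congrArg (fun f => Polynomial.coeff f b) h
  rw [← map_natCast (Polynomial.C : R →+* _), ← map_natCast (Polynomial.C : R →+* _),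
    ← map_natCast (Polynomial.C : R →+* _),
    ← map_pow (Polynomial.C : R →+* _), Polynomial.coeff_C_mul, Polynomial.coeff_C_mul,
    Polynomial.coeff_C_mul, coeff_coeff_swapPoly, coeff_linear_pow_mul_linear_pow,
    Polynomial.coeff_mul_C] at h'
  exact h'

end DiagonalExtraction

/-! ### The tetrahedral configuration and the closed form of the diagonal. -/

theorem coeff_linear_cube_pow (p q : ℂ) (n b : ℕ) :
    ((Polynomial.C p + Polynomial.X ^ 3 * Polynomial.C q) ^ n).coeff b
      = if 3 ∣ b then (n.choose (b / 3) : ℂ) * p ^ (n - b / 3) * q ^ (b / 3) else 0 := by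
  have h : (Polynomial.C p + Polynomial.X ^ 3 * Polynomial.C q) ^ n
      = Polynomial.expand ℂ 3 ((Polynomial.C p + Polynomial.X * Polynomial.C q) ^ n) := by
    simp
  rw [h, Polynomial.coeff_expand (by norm_num), coeff_linear_pow]

/-- The slopes of the linear forms of the tetrahedral configuration. -/
noncomputable def tetraL (w : ℂ) : Fin 4 → ℂ := ![0, 1, w ^ 2, w]

/-- The first dual components of the tetrahedral configuration. -/
noncomputable def tetraA : Fin 4 → ℂ := ![1, 1 / 3, 1 / 3, 1 / 3]

/-- The second dual components of the tetrahedral configuration. -/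
noncomputable def tetraB (w : ℂ) : Fin 4 → ℂ := ![0, 2 / 3, 2 / 3 * w, 2 / 3 * w ^ 2]

theorem prod_tetraL {w : ℂ} (hw : w ^ 2 + w + 1 = 0) (n : ℕ) :
    ∏ j, (1 + Polynomial.X * Polynomial.C (tetraL w j)) ^ n
      = (Polynomial.C 1 + Polynomial.X ^ 3 * Polynomial.C 1) ^ n := by
  rw [Finset.prod_pow]
  congr 1
  have h : Polynomial.C w ^ 2 + Polynomial.C w + 1 = (0 : Polynomial ℂ) := by
    rw [← map_pow, ← map_add, ← map_one Polynomial.C, ← map_add, hw, map_zero]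
  simp only [Fin.prod_univ_four, tetraL, Matrix.cons_val, map_zero, map_one, map_pow, mul_zero,
    add_zero, one_mul, mul_one]
  generalize Polynomial.C w = W at h
  generalize (Polynomial.X : Polynomial ℂ) = Y
  linear_combination (Y + Y ^ 2 * W + Y ^ 3 * (W - 1)) * h

theorem prod_tetraAB {w : ℂ} (hw : w ^ 2 + w + 1 = 0) (n : ℕ) :
    ∏ j, (Polynomial.C (tetraA j) + Polynomial.X * Polynomial.C (tetraB w j)) ^ n
      = (Polynomial.C (1 / 27) + Polynomial.X ^ 3 * Polynomial.C (8 / 27)) ^ n := by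
  rw [Finset.prod_pow]
  congr 1
  have h : Polynomial.C w ^ 2 + Polynomial.C w + 1 = (0 : Polynomial ℂ) := by
    rw [← map_pow, ← map_add, ← map_one Polynomial.C, ← map_add, hw, map_zero]
  have e1 : Polynomial.C (2 / 3 : ℂ) = 2 * Polynomial.C (1 / 3) := by
    rw [← map_ofNat Polynomial.C 2, ← map_mul]; norm_num
  have e2 : Polynomial.C (1 / 27 : ℂ) = Polynomial.C (1 / 3) ^ 3 := by
    rw [← map_pow]; norm_num
  have e3 : Polynomial.C (8 / 27 : ℂ) = 8 * Polynomial.C (1 / 3) ^ 3 := by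
    rw [← map_pow, ← map_ofNat Polynomial.C 8, ← map_mul]; norm_num
  simp only [Fin.prod_univ_four, tetraA, tetraB, Matrix.cons_val, map_zero, map_one, map_pow,
    map_mul, mul_zero, add_zero, one_mul, e1, e2, e3]
  generalize Polynomial.C w = W at h
  generalize (Polynomial.X : Polynomial ℂ) = Y
  generalize Polynomial.C (1 / 3 : ℂ) = v
  linear_combination v ^ 3 * (2 * Y + 4 * Y ^ 2 * W + 8 * Y ^ 3 * (W - 1)) * h

/-- The coefficient of `x_i x_j` is `(α_i β_j - α_j β_i)(l_j - l_i)`, which equals `2/3` for every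
pair because `w` is a primitive cube root of unity. -/
theorem tetra_det {w : ℂ} (hw : w ^ 2 + w + 1 = 0) :
    1 - (linForm tetraA + linForm fun j => tetraB w j * tetraL w j)
      + (linForm tetraA * linForm (fun j => tetraB w j * tetraL w j)
        - linForm (fun j => tetraA j * tetraL w j) * linForm (tetraB w))
      = MvPolynomial.map (algebraMap ℚ ℂ) (symDenominator (2 / 3) 0 0) := by
  have h : MvPolynomial.C w ^ 2 + MvPolynomial.C w + 1 = (0 : MvPolynomial (Fin 4) ℂ) := by
    rw [← map_pow, ← map_add, ← map_one MvPolynomial.C, ← map_add, hw, map_zero]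
  have e1 : (MvPolynomial.C (2 / 3 : ℂ) : MvPolynomial (Fin 4) ℂ)
      = 2 * MvPolynomial.C (1 / 3) := by
    rw [← map_ofNat MvPolynomial.C 2, ← map_mul]; norm_num
  have e2 : 3 * (MvPolynomial.C (1 / 3 : ℂ) : MvPolynomial (Fin 4) ℂ) = 1 := by
    rw [← map_ofNat MvPolynomial.C 3, ← map_mul]; norm_num
  have e3 : Finset.powersetCard 2 (Finset.univ : Finset (Fin 4))
      = {{0, 1}, {0, 2}, {0, 3}, {1, 2}, {1, 3}, {2, 3}} := by decide
  have e4 : MvPolynomial.map (algebraMap ℚ ℂ) (MvPolynomial.esymm (Fin 4) ℚ 2)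
      = MvPolynomial.X 0 * MvPolynomial.X 1 + MvPolynomial.X 0 * MvPolynomial.X 2
        + MvPolynomial.X 0 * MvPolynomial.X 3 + MvPolynomial.X 1 * MvPolynomial.X 2
        + MvPolynomial.X 1 * MvPolynomial.X 3 + MvPolynomial.X 2 * MvPolynomial.X 3 := by
    rw [MvPolynomial.map_esymm, MvPolynomial.esymm, e3]
    rw [Finset.sum_insert (by decide), Finset.sum_insert (by decide),
      Finset.sum_insert (by decide), Finset.sum_insert (by decide),
      Finset.sum_insert (by decide), Finset.sum_singleton]
    simp
    ring
  simp only [symDenominator, map_add, map_sub, map_mul, map_one, e4, MvPolynomial.esymm_one,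
    MvPolynomial.map_C, MvPolynomial.map_X, map_zero, zero_mul, add_zero,
    map_div₀, map_ofNat, e1, linForm, Fin.sum_univ_four, tetraA, tetraB, tetraL, Matrix.cons_val,
    MvPolynomial.smul_eq_C_mul, map_pow, mul_zero, one_mul, mul_one]
  generalize MvPolynomial.C w = W at h
  generalize (MvPolynomial.C (1 / 3 : ℂ) : MvPolynomial (Fin 4) ℂ) = v at e2
  generalize (MvPolynomial.X 0 : MvPolynomial (Fin 4) ℂ) = x0
  generalize (MvPolynomial.X 1 : MvPolynomial (Fin 4) ℂ) = x1
  generalize (MvPolynomial.X 2 : MvPolynomial (Fin 4) ℂ) = x2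
  generalize (MvPolynomial.X 3 : MvPolynomial (Fin 4) ℂ) = x3
  linear_combination
    (2 * v ^ 2 * ((W - 2) * (x1 * x2 + x1 * x3) + (-W ^ 2 + 3 * W - 3) * x2 * x3)
      + 2 * v * (W - 1) * (x0 - 1) * (x2 + x3)) * h
    + (2 * v * (x1 * x2 + x1 * x3 + x2 * x3) - (x1 + x2 + x3)) * e2

theorem isHomogeneous_linForm {R : Type*} [CommRing R] (w : Fin 4 → R) :
    (linForm w).IsHomogeneous 1 := by
  refine MvPolynomial.IsHomogeneous.sum _ _ _ fun i _ => ?_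
  rw [MvPolynomial.smul_eq_C_mul]
  simpa using (MvPolynomial.isHomogeneous_C (Fin 4) (w i)).mul (MvPolynomial.isHomogeneous_X R i)

theorem map_coe_mvPowerSeries {σ : Type*} (f : MvPolynomial σ ℚ) :
    MvPowerSeries.map (algebraMap ℚ ℂ) (f : MvPowerSeries σ ℚ)
      = ((MvPolynomial.map (algebraMap ℚ ℂ) f : MvPolynomial σ ℂ) : MvPowerSeries σ ℂ) := by
  ext d
  simp [MvPolynomial.coeff_map]

theorem coeff_diagExp_tetra {w : ℂ} (hw : w ^ 2 + w + 1 = 0) {n a b : ℕ} (hab : a + b = 4 * n) :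
    (n.factorial : ℂ) ^ 4 * MvPolynomial.coeff (diagExp n)
        (mixedCoeff (linForm tetraA) (linForm fun j => tetraB w j * tetraL w j)
          (linForm (fun j => tetraA j * tetraL w j) * linForm (tetraB w)) a b)
      = if 3 ∣ b then (a.factorial : ℂ) * b.factorial * (n.choose (b / 3) : ℂ) ^ 2
          * (1 / 27) ^ (n - b / 3) * (8 / 27) ^ (b / 3) else 0 := by
  have h := coeff_diagExp_mixedCoeff tetraA (tetraB w) (tetraL w) hab
  rw [prod_tetraL hw, prod_tetraAB hw, coeff_linear_cube_pow, coeff_linear_cube_pow] at h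
  have hc : ((4 * n).factorial : ℂ) = ((4 * n).choose b : ℂ) * (b.factorial * a.factorial) := by
    have := Nat.choose_mul_factorial_mul_factorial (show b ≤ 4 * n by omega)
    rw [show 4 * n - b = a by omega] at this
    rw [← this]
    push_cast
    ring
  have hne : ((4 * n).choose b : ℂ) ≠ 0 := by
    exact_mod_cast (Nat.choose_pos (show b ≤ 4 * n by omega)).ne'
  apply mul_left_cancel₀ hne
  rw [mul_left_comm, h, hc]
  split_ifs <;> ring

theorem coeff_diagExp_hSeries (n : ℕ) :
    (n.factorial : ℂ) ^ 4
        * ((MvPowerSeries.coeff (diagExp n) (hSeries (2 / 3) 0 0) : ℚ) : ℂ)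
      = ∑ k ∈ Finset.range (n + 1), ((4 * n - 3 * k).factorial : ℂ) * (3 * k).factorial
          * (n.choose k : ℂ) ^ 2 * (1 / 27) ^ (n - k) * (8 / 27) ^ k := by
  obtain ⟨w, hw⟩ : ∃ w : ℂ, w ^ 2 + w + 1 = 0 := by
    -- A primitive cube root of unity is `(√-3 - 1) / 2`.
    obtain ⟨w, hw⟩ := IsAlgClosed.exists_pow_nat_eq (-3 : ℂ) (n := 2) (by norm_num)
    exact ⟨(w - 1) / 2, by linear_combination hw / 4⟩
  have hinv := congrArg (MvPowerSeries.map (algebraMap ℚ ℂ)) (symDenominator_mul_hSeries (2 / 3) 0 0)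
  rw [map_mul, map_coe_mvPowerSeries, ← tetra_det hw, map_one] at hinv
  have h := coeff_inv_det_eq_coeff_symTrace (isHomogeneous_linForm _) (isHomogeneous_linForm _)
    ((isHomogeneous_linForm _).mul (isHomogeneous_linForm _)) hinv (diagExp n)
  have hdeg : (diagExp n).degree = 4 * n := by
    rw [Finsupp.degree_eq_sum]
    simp [diagExp]
  rw [MvPowerSeries.coeff_map, hdeg, symTrace, MvPolynomial.coeff_sum,
    Finset.Nat.sum_antidiagonal_eq_sum_range_succ_mk, ← Finset.sum_range_reflect] at h
  rw [show ((MvPowerSeries.coeff (diagExp n) (hSeries (2 / 3) 0 0) : ℚ) : ℂ)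
    = algebraMap ℚ ℂ (MvPowerSeries.coeff (diagExp n) (hSeries (2 / 3) 0 0)) from rfl, h,
    Finset.mul_sum]
  have hsub : (Finset.range (n + 1)).image (3 * ·) ⊆ Finset.range (4 * n + 1) := by
    intro x hx
    simp only [Finset.mem_image, Finset.mem_range] at hx ⊢
    omega
  have hterm : ∀ b ∈ Finset.range (4 * n + 1), _ := fun b hb =>
    coeff_diagExp_tetra hw (n := n) (a := 4 * n - b) (b := b)
      (by have := Finset.mem_range.mp hb; omega)
  rw [Finset.sum_congr rfl (g := fun b => if 3 ∣ b then ((4 * n - b).factorial : ℂ) * b.factorial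
      * (n.choose (b / 3) : ℂ) ^ 2 * (1 / 27) ^ (n - b / 3) * (8 / 27) ^ (b / 3) else 0)]
  · rw [← Finset.sum_subset hsub, Finset.sum_image (fun x _ y _ h => by simpa using h)]
    · refine Finset.sum_congr rfl fun k _ => ?_
      rw [if_pos (dvd_mul_right 3 k), Nat.mul_div_cancel_left k (by norm_num)]
    -- An index that is not `3k` with `k ≤ n` is either no multiple of `3`, or has `k > n` and a
    -- vanishing binomial.
    · intro b _ hb
      split_ifs with h3
      · obtain ⟨k, rfl⟩ := h3
        have hk : n < k := by
          by_contra hk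
          exact hb (Finset.mem_image_of_mem _ (Finset.mem_range.mpr (by omega)))
        rw [Nat.mul_div_cancel_left k (by norm_num), Nat.choose_eq_zero_of_lt hk]
        simp
      · rfl
  · intro b hb
    have hb' := Finset.mem_range.mp hb
    rw [← hterm b hb]
    simp only [show 4 * n + 1 - 1 - b = 4 * n - b by omega,
      show 4 * n - (4 * n - b) = b by omega]

theorem scaledDiag_eq (n : ℕ) : scaledDiag n = ((2 * n).choose n : ℚ) * diagQuot n := by
  have h : (n.factorial : ℚ) ^ 4 * MvPowerSeries.coeff (diagExp n) (hSeries (2 / 3) 0 0)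
      = ∑ k ∈ Finset.range (n + 1), ((4 * n - 3 * k).factorial : ℚ) * (3 * k).factorial
          * (n.choose k : ℚ) ^ 2 * (1 / 27) ^ (n - k) * (8 / 27) ^ k := by
    have := coeff_diagExp_hSeries n
    apply Rat.cast_injective (α := ℂ)
    push_cast
    exact this
  have hn : (n.factorial : ℚ) ≠ 0 := by positivity
  have hn4 : (n.factorial : ℚ) ^ 4 ≠ 0 := by positivity
  apply mul_left_cancel₀ hn4
  rw [scaledDiag, show (Finsupp.equivFunOnFinite.symm fun _ : Fin 4 => n) = diagExp n from rfl,
    mul_left_comm, h, diagQuot, Finset.mul_sum, Finset.mul_sum, Finset.mul_sum]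
  refine Finset.sum_congr rfl fun k hk => ?_
  obtain ⟨m, rfl⟩ := Nat.exists_eq_add_of_le (Finset.mem_range_succ_iff.mp hk)
  have h1 : (((2 * (k + m)).choose (k + m) : ℕ) : ℚ)
      = (2 * (k + m)).factorial / ((k + m).factorial * (k + m).factorial) := by
    rw [Nat.cast_choose ℚ (by omega), show 2 * (k + m) - (k + m) = k + m by omega]
  have h2 : (((k + m).choose k : ℕ) : ℚ) = (k + m).factorial / (k.factorial * m.factorial) := by
    rw [Nat.cast_choose ℚ (by omega), Nat.add_sub_cancel_left]
  rw [h1, h2, diagTerm, Nat.add_sub_cancel_left]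
  have h3 : ((9 : ℚ)) ^ (k + m) * ((1 / 27) ^ m * (8 / 27) ^ k) = 8 ^ k / 3 ^ (k + m) := by
    have e9 : (9 : ℚ) ^ (k + m) = (3 ^ (k + m)) ^ 2 := by
      rw [← pow_mul, mul_comm, pow_mul]; norm_num
    have e27 : ∀ i : ℕ, (27 : ℚ) ^ i = (3 ^ i) ^ 3 := fun i => by
      rw [← pow_mul, mul_comm, pow_mul]; norm_num
    rw [div_pow, div_pow, e9, e27, e27, pow_add, one_pow]
    field_simp
  have h4 : (k.factorial : ℚ) ≠ 0 := by positivity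
  have h5 : (m.factorial : ℚ) ≠ 0 := by positivity
  have h6 : ((2 * (k + m)).factorial : ℚ) ≠ 0 := by positivity
  calc _ = (9 ^ (k + m) * ((1 / 27) ^ m * (8 / 27) ^ k))
        * (((4 * (k + m) - 3 * k).factorial : ℚ) * (3 * k).factorial
          * ((k + m).factorial / (k.factorial * m.factorial)) ^ 2) := by ring
    _ = _ := by
      rw [h3]
      field_simp

/-! ### Termwise differentiation of power series with geometrically bounded coefficients. -/

section PowerSeries

/-- The sum of the power series with coefficients `c`. -/
noncomputable def seriesFun (c : ℕ → ℂ) (z : ℂ) : ℂ := ∑' n, c n * z ^ n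

variable {c : ℕ → ℂ} {M B : ℝ}

theorem norm_term_le (hM : 0 ≤ M) (hB : 0 < B) (hc : ∀ n, ‖c n‖ ≤ M * B ^ n) (n : ℕ) (z : ℂ)
    (hz : z ∈ Metric.ball (0 : ℂ) (1 / (2 * B))) : ‖c n * z ^ n‖ ≤ M * (1 / 2) ^ n := by
  have hz' : ‖z‖ ≤ 1 / (2 * B) := (mem_ball_zero_iff.mp hz).le
  calc ‖c n * z ^ n‖ = ‖c n‖ * ‖z‖ ^ n := by rw [norm_mul, norm_pow]
    _ ≤ (M * B ^ n) * (1 / (2 * B)) ^ n := by gcongr; exact hc n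
    _ = M * (B * (1 / (2 * B))) ^ n := by rw [mul_pow]; ring
    _ = M * (1 / 2) ^ n := by congr 2; field_simp

theorem summable_half (M : ℝ) : Summable fun n : ℕ => M * (1 / 2 : ℝ) ^ n :=
  (summable_geometric_of_lt_one (by norm_num) (by norm_num)).mul_left M

theorem hasSum_seriesFun (hM : 0 ≤ M) (hB : 0 < B) (hc : ∀ n, ‖c n‖ ≤ M * B ^ n) {z : ℂ}
    (hz : z ∈ Metric.ball (0 : ℂ) (1 / (2 * B))) :
    HasSum (fun n => c n * z ^ n) (seriesFun c z) :=
  (Summable.of_norm_bounded (summable_half M) fun n => norm_term_le hM hB hc n z hz).hasSum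

theorem differentiableOn_seriesFun (hM : 0 ≤ M) (hB : 0 < B) (hc : ∀ n, ‖c n‖ ≤ M * B ^ n) :
    DifferentiableOn ℂ (seriesFun c) (Metric.ball (0 : ℂ) (1 / (2 * B))) :=
  Complex.differentiableOn_tsum_of_summable_norm (summable_half M)
    (fun n => by fun_prop) Metric.isOpen_ball fun n z hz => norm_term_le hM hB hc n z hz

theorem analyticAt_seriesFun (hM : 0 ≤ M) (hB : 0 < B) (hc : ∀ n, ‖c n‖ ≤ M * B ^ n) :
    AnalyticAt ℂ (seriesFun c) 0 :=
  (differentiableOn_seriesFun hM hB hc).analyticAt (Metric.ball_mem_nhds _ (by positivity))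

theorem hasSum_theta (hM : 0 ≤ M) (hB : 0 < B) (hc : ∀ n, ‖c n‖ ≤ M * B ^ n) {z : ℂ}
    (hz : z ∈ Metric.ball (0 : ℂ) (1 / (2 * B))) :
    HasSum (fun n : ℕ => (n : ℂ) * c n * z ^ n) (z * deriv (seriesFun c) z) := by
  have h := (Complex.hasSum_deriv_of_summable_norm (F := fun n z => c n * z ^ n) (summable_half M)
    (fun n => by fun_prop) Metric.isOpen_ball
    (fun n z hz => norm_term_le hM hB hc n z hz) hz).mul_left z
  have e : (fun n : ℕ => (n : ℂ) * c n * z ^ n)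
      = fun n : ℕ => z * deriv (fun z : ℂ => c n * z ^ n) z := by
    funext n
    have : deriv (fun z : ℂ => c n * z ^ n) z = c n * (n * z ^ (n - 1)) := by
      rw [deriv_const_mul_field, deriv_pow_field]
    rw [this]
    rcases n with _ | n
    · simp
    · simp only [Nat.add_sub_cancel]
      ring
  rw [e]
  exact h

/-- Doubling `B` absorbs the factor `n`, so that `hasSum_theta` can be applied a second time to
obtain `θ²`. -/
theorem norm_natCast_mul_le (hc : ∀ n, ‖c n‖ ≤ M * B ^ n) (n : ℕ) :
    ‖(n : ℂ) * c n‖ ≤ M * (2 * B) ^ n := by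
  have h1 : (n : ℝ) ≤ 2 ^ n := by exact_mod_cast Nat.lt_two_pow_self.le
  calc ‖(n : ℂ) * c n‖ = n * ‖c n‖ := by rw [norm_mul, Complex.norm_natCast]
    _ ≤ 2 ^ n * (M * B ^ n) := by gcongr; exact hc n
    _ = M * (2 * B) ^ n := by rw [mul_pow]; ring

/-- Termwise application of `θ = z d/dz` and of `θ²` to a power series. -/
theorem eventually_hasSum_theta (hM : 0 ≤ M) (hB : 0 < B) (hc : ∀ n, ‖c n‖ ≤ M * B ^ n) :
    ∀ᶠ z in 𝓝 (0 : ℂ), HasSum (fun n => c n * z ^ n) (seriesFun c z) ∧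
      HasSum (fun n : ℕ => (n : ℂ) * c n * z ^ n) (z * deriv (seriesFun c) z) ∧
      HasSum (fun n : ℕ => (n : ℂ) ^ 2 * c n * z ^ n)
        (z * deriv (seriesFun c) z + z ^ 2 * deriv (deriv (seriesFun c)) z) := by
  have hc' := norm_natCast_mul_le hc
  have hB' : 0 < 2 * B := by positivity
  filter_upwards [Metric.ball_mem_nhds (0 : ℂ) (show 0 < 1 / (2 * B) by positivity),
    Metric.ball_mem_nhds (0 : ℂ) (show 0 < 1 / (2 * (2 * B)) by positivity),
    (Metric.isOpen_ball.eventually_mem (Metric.mem_ball_self (x := (0 : ℂ))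
      (show 0 < 1 / (2 * B) by positivity))).eventually_nhds,
    (analyticAt_seriesFun hM hB hc).deriv.eventually_analyticAt] with z hz hz' hzn han
  refine ⟨hasSum_seriesFun hM hB hc hz, hasSum_theta hM hB hc hz, ?_⟩
  have h := hasSum_theta hM hB' hc' hz'
  have hev : seriesFun (fun n : ℕ => (n : ℂ) * c n) =ᶠ[𝓝 z]
      fun x => x * deriv (seriesFun c) x := by
    filter_upwards [hzn] with x hx
    exact (hasSum_theta hM hB hc hx).tsum_eq
  rw [hev.deriv_eq, deriv_fun_mul differentiableAt_fun_id han.differentiableAt, deriv_id''] at h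
  convert h using 1
  · funext n; ring
  · ring

end PowerSeries

/-! ### The differential equation of the generating function and its analytic solutions. -/

/-- A function that is continuous at `0`, and whose product with `z` vanishes near `0`, vanishes
near `0`. -/
theorem eventually_eq_zero_of_mul {H : ℂ → ℂ} (hH : ContinuousAt H 0)
    (h : ∀ᶠ z in 𝓝 (0 : ℂ), z * H z = 0) : ∀ᶠ z in 𝓝 (0 : ℂ), H z = 0 := by
  have h' : H =ᶠ[𝓝[≠] 0] fun _ => 0 := by
    filter_upwards [h.filter_mono nhdsWithin_le_nhds, self_mem_nhdsWithin] with z hz hz0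
    exact (mul_eq_zero.mp hz).resolve_left hz0
  exact (hH.eventuallyEq_nhds_iff_eventuallyEq_nhdsNE continuousAt_const).mp h'

theorem eq_zero_of_hasSum {f : ℕ → ℂ} {a : ℂ} (h : HasSum f a) (h0 : ∀ n, f n = 0) : a = 0 := by
  rw [funext h0] at h
  exact h.unique hasSum_zero

/-- By positivity the third term of the recurrence can be dropped, which leaves `u_{n+2} ≤ 50
u_{n+1}`: the difference of the coefficients is `38 n² + 264 n + 340 ≥ 0`. A crude bound suffices
for a positive radius of convergence. -/
theorem norm_diagQuot_le (n : ℕ) : ‖(diagQuot n : ℂ)‖ ≤ 1 * 50 ^ n := by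
  have hR : ∀ n, (diagQuot n ≤ 50 ^ n ∧ diagQuot (n + 1) ≤ 50 ^ (n + 1)) := by
    intro n
    induction n with
    | zero => simp [diagQuot_values.1, diagQuot_values.2.1]; norm_num
    | succ n ih =>
      refine ⟨ih.2, ?_⟩
      have hr := diagQuot_rec n
      have hp := diagQuot_pos n
      have hp1 := diagQuot_pos (n + 1)
      have hn : (0 : ℚ) ≤ n := n.cast_nonneg
      have h1 : 3 * ((n : ℚ) + 2) ^ 2 * diagQuot (n + 2)
          ≤ 3 * ((n : ℚ) + 2) ^ 2 * (50 * diagQuot (n + 1)) := by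
        nlinarith [mul_nonneg (show (0 : ℚ) ≤ 64 * (4 * n + 3) * (4 * n + 5) by positivity) hp.le,
          mul_nonneg (show (0 : ℚ) ≤ 38 * n ^ 2 + 264 * n + 340 by positivity) hp1.le]
      have h2 := le_of_mul_le_mul_left h1 (by positivity)
      rw [pow_succ]
      linarith [ih.2]
  have h := (hR n).1
  rw [Complex.norm_ratCast, abs_of_pos (by exact_mod_cast diagQuot_pos n), one_mul]
  exact_mod_cast h

/-- The generating function of `u_n`. -/
noncomputable def diagFun : ℂ → ℂ := seriesFun fun n => (diagQuot n : ℂ)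

theorem analyticAt_diagFun : AnalyticAt ℂ diagFun 0 :=
  analyticAt_seriesFun zero_le_one (by norm_num) norm_diagQuot_le

theorem seriesFun_zero (c : ℕ → ℂ) : seriesFun c 0 = c 0 := by
  rw [seriesFun, tsum_eq_single 0]
  · simp
  · intro n hn
    simp [hn]

theorem diagFun_zero : diagFun 0 = 1 := by
  rw [diagFun, seriesFun_zero, diagQuot_values.1, Rat.cast_one]

theorem solvesDiagODE_diagFun : SolvesDiagODE diagFun := by
  have han := analyticAt_diagFun
  refine eventually_eq_zero_of_mul ?_ ?_
  · have h0 := han.continuousAt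
    have h1 := han.deriv.continuousAt
    have h2 := han.deriv.deriv.continuousAt
    fun_prop
  filter_upwards [eventually_hasSum_theta zero_le_one (by norm_num) norm_diagQuot_le]
    with z ⟨h0, h1, h2⟩
  have hA := h2.mul_left 3
  have hB := ((((h2.mul_left 28).add (h1.mul_left 28)).add (h0.mul_left 9))).mul_left (4 * z)
  have hC := ((((h2.mul_left 16).add (h1.mul_left 32)).add (h0.mul_left 15))).mul_left (64 * z ^ 2)
  -- Shifts by 2, 1 and 0 align the three series at `z ^ (n + 2)`. The terms split off cancel, since
  -- `3 u₁ = 36 u₀`.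
  rw [← hasSum_nat_add_iff' 2] at hA
  rw [← hasSum_nat_add_iff' 1] at hB
  have hD := hA.sub (hB.sub hC)
  have hz : ∀ n : ℕ, 3 * ((n : ℂ) + 2) ^ 2 * diagQuot (n + 2)
      - 4 * (28 * ((n : ℂ) + 1) ^ 2 + 28 * ((n : ℂ) + 1) + 9) * diagQuot (n + 1)
      + 64 * (4 * (n : ℂ) + 3) * (4 * (n : ℂ) + 5) * diagQuot n = 0 := fun n => by
    have := congrArg (Rat.cast : ℚ → ℂ) (diagQuot_rec n)
    push_cast at this
    exact this
  have hE := eq_zero_of_hasSum hD fun n => by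
    push_cast
    linear_combination z ^ (n + 2) * hz n
  simp only [Finset.sum_range_succ, Finset.sum_range_zero, diagQuot_values.1,
    diagQuot_values.2.1] at hE
  push_cast at hE
  change z * (z * (1 - 16 * z) * (3 - 64 * z) * deriv (deriv (seriesFun _)) z
      + (3 - 224 * z + 3072 * z ^ 2) * deriv (seriesFun _) z + (960 * z - 36) * seriesFun _ z) = 0
  linear_combination hE

/-- An analytic solution of the differential equation that vanishes at `0` vanishes near `0`. -/
theorem SolvesDiagODE.eventually_eq_zero {f : ℂ → ℂ} (hf : AnalyticAt ℂ f 0) (h0 : f 0 = 0)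
    (hode : SolvesDiagODE f) : ∀ᶠ z in 𝓝 (0 : ℂ), f z = 0 := by
  by_contra hne
  obtain ⟨m, k, hk, hk0, hfk⟩ := hf.exists_eventuallyEq_pow_smul_nonzero_iff.mpr hne
  simp only [sub_zero, smul_eq_mul] at hfk
  rcases m with _ | m
  · have := hfk.self_of_nhds
    rw [h0] at this
    simp only [pow_zero, one_mul] at this
    exact hk0 this.symm
  have hk1 := hk.deriv
  have hd1 : ∀ᶠ z in 𝓝 (0 : ℂ), deriv f z = (m + 1) * z ^ m * k z + z ^ (m + 1) * deriv k z := by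
    filter_upwards [hfk.eventually_nhds, hk.eventually_analyticAt] with z hz hkz
    have hz' : f =ᶠ[𝓝 z] fun z => z ^ (m + 1) * k z := hz
    rw [hz'.deriv_eq]
    have := (hasDerivAt_pow (m + 1) z).fun_mul hkz.differentiableAt.hasDerivAt
    rw [this.deriv]
    push_cast
    simp
  -- The factor `z` avoids the exponent `m - 1`, so `m = 0` fits the same formula.
  have hd2 : ∀ᶠ z in 𝓝 (0 : ℂ), z * deriv (deriv f) z = z ^ m * ((m + 1) * m * k z
      + 2 * (m + 1) * z * deriv k z + z ^ 2 * deriv (deriv k) z) := by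
    filter_upwards [hd1.eventually_nhds, hk.eventually_analyticAt, hk1.eventually_analyticAt]
      with z hz hkz hkz1
    have hz' : deriv f =ᶠ[𝓝 z] fun z => (m + 1) * z ^ m * k z + z ^ (m + 1) * deriv k z := hz
    rw [hz'.deriv_eq]
    have := ((((hasDerivAt_pow m z).const_mul ((m : ℂ) + 1)).fun_mul
      hkz.differentiableAt.hasDerivAt)).fun_add
      ((hasDerivAt_pow (m + 1) z).fun_mul hkz1.differentiableAt.hasDerivAt)
    rw [this.deriv]
    push_cast
    rcases m with _ | m
    · simp; ring
    · simp only [Nat.add_sub_cancel]; push_cast; ring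
  -- `H` is the equation for `z ^ (m + 1) * k z` divided by `z ^ m`. Its value at `0` is the
  -- indicial polynomial at `m + 1` times `k 0`, that is `3 (m + 1)² k 0 ≠ 0`.
  set H : ℂ → ℂ := fun z => (1 - 16 * z) * (3 - 64 * z) * ((m + 1) * m * k z
      + 2 * (m + 1) * z * deriv k z + z ^ 2 * deriv (deriv k) z)
      + (3 - 224 * z + 3072 * z ^ 2) * ((m + 1) * k z + z * deriv k z)
      + (960 * z - 36) * (z * k z) with hH
  have hHc : ContinuousAt H 0 := by
    have c0 := hk.continuousAt
    have c1 := hk1.continuousAt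
    have c2 := hk1.deriv.continuousAt
    fun_prop
  have hH0 : H =ᶠ[𝓝[≠] 0] fun _ => 0 := by
    filter_upwards [(hfk.and (hd1.and (hd2.and hode))).filter_mono nhdsWithin_le_nhds,
      self_mem_nhdsWithin] with z ⟨a0, a1, a2, a3⟩ hz
    have hzm : z ^ m ≠ 0 := pow_ne_zero _ hz
    apply (mul_eq_zero.mp _).resolve_left hzm
    rw [a1, a0] at a3
    simp only [hH]
    linear_combination a3 - (1 - 16 * z) * (3 - 64 * z) * a2
  have hval := ((hHc.eventuallyEq_nhds_iff_eventuallyEq_nhdsNE continuousAt_const).mp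
    hH0).self_of_nhds
  have : 3 * ((m : ℂ) + 1) ^ 2 * k 0 = 0 := by
    simp only [hH] at hval
    linear_combination hval
  have hm : (m : ℂ) + 1 ≠ 0 := Nat.cast_add_one_ne_zero m
  simp [hm, hk0] at this

theorem SolvesDiagODE.unique {f g : ℂ → ℂ} (hf : AnalyticAt ℂ f 0) (hg : AnalyticAt ℂ g 0)
    (h0 : f 0 = g 0) (hodef : SolvesDiagODE f) (hodeg : SolvesDiagODE g) : f =ᶠ[𝓝 0] g := by
  have h1 : ∀ᶠ z in 𝓝 (0 : ℂ), deriv (fun z => f z - g z) z = deriv f z - deriv g z := by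
    filter_upwards [hf.eventually_analyticAt, hg.eventually_analyticAt] with z hfz hgz
    exact deriv_fun_sub hfz.differentiableAt hgz.differentiableAt
  have hode : SolvesDiagODE fun z => f z - g z := by
    filter_upwards [hodef, hodeg, h1, h1.eventually_nhds, hf.deriv.eventually_analyticAt,
      hg.deriv.eventually_analyticAt] with z a b c d hfz hgz
    have d' : deriv (fun z => f z - g z) =ᶠ[𝓝 z] fun z => deriv f z - deriv g z := d
    rw [d'.deriv_eq, c, deriv_fun_sub hfz.differentiableAt hgz.differentiableAt]
    linear_combination a - b
  filter_upwards [hode.eventually_eq_zero (hf.fun_sub hg) (sub_eq_zero.mpr h0)] with z hz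
  exact sub_eq_zero.mp hz

/-! ### Gauss's equation and the two hypergeometric pullbacks. -/

/-- The coefficients of `₂F₁ a b 1`. -/
noncomputable def hypCoeff (a b : ℂ) (n : ℕ) : ℂ := ordinaryHypergeometricCoefficient a b 1 n

theorem hyp_eq_seriesFun (a b : ℂ) : (₂F₁ a b (1 : ℂ) : ℂ → ℂ) = seriesFun (hypCoeff a b) := by
  rw [ordinaryHypergeometric_eq_tsum]
  rfl

theorem hypCoeff_succ (a b : ℂ) (n : ℕ) :
    ((n : ℂ) + 1) ^ 2 * hypCoeff a b (n + 1) = (n + a) * (n + b) * hypCoeff a b n := by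
  have hn : (n : ℂ) + 1 ≠ 0 := Nat.cast_add_one_ne_zero n
  have hn' : 1 + (n : ℂ) ≠ 0 := by rwa [add_comm]
  have hf : (n.factorial : ℂ) ≠ 0 := by exact_mod_cast n.factorial_ne_zero
  simp only [hypCoeff, ordinaryHypergeometricCoefficient, ascPochhammer_succ_eval,
    ascPochhammer_eval_one, Nat.factorial_succ]
  push_cast
  field_simp
  ring

theorem norm_hypCoeff_le {a b : ℂ} (ha : ‖a‖ ≤ 1) (hb : ‖b‖ ≤ 1) (n : ℕ) :
    ‖hypCoeff a b n‖ ≤ 1 * 1 ^ n := by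
  rw [one_pow, mul_one]
  induction n with
  | zero => simp [hypCoeff, ordinaryHypergeometricCoefficient]
  | succ n ih =>
    have h := congrArg norm (hypCoeff_succ a b n)
    have hn : ‖(n : ℂ) + 1‖ = n + 1 := by
      rw [← Nat.cast_add_one, Complex.norm_natCast]; push_cast; rfl
    rw [norm_mul, norm_mul, norm_mul, norm_pow, hn] at h
    have h1 : ‖(n : ℂ) + a‖ ≤ n + 1 := (norm_add_le _ _).trans (by
      rw [Complex.norm_natCast]; linarith)
    have h2 : ‖(n : ℂ) + b‖ ≤ n + 1 := (norm_add_le _ _).trans (by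
      rw [Complex.norm_natCast]; linarith)
    have hp : (0 : ℝ) < (n + 1) ^ 2 := by positivity
    refine le_of_mul_le_mul_left ?_ hp
    rw [h]
    calc _ ≤ ((n : ℝ) + 1) * (n + 1) * 1 := by gcongr
      _ = _ := by ring

theorem analyticAt_hyp {a b : ℂ} (ha : ‖a‖ ≤ 1) (hb : ‖b‖ ≤ 1) :
    AnalyticAt ℂ (₂F₁ a b (1 : ℂ) : ℂ → ℂ) 0 := by
  rw [hyp_eq_seriesFun]
  exact analyticAt_seriesFun zero_le_one one_pos (norm_hypCoeff_le ha hb)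

/-- Gauss's hypergeometric differential equation, with `c = 1`. -/
theorem hyp_ode {a b : ℂ} (ha : ‖a‖ ≤ 1) (hb : ‖b‖ ≤ 1) :
    ∀ᶠ w in 𝓝 (0 : ℂ), w * (1 - w) * deriv (deriv (₂F₁ a b (1 : ℂ))) w
      + (1 - (1 + a + b) * w) * deriv (₂F₁ a b (1 : ℂ)) w - a * b * ₂F₁ a b (1 : ℂ) w = 0 := by
  have han := analyticAt_hyp ha hb
  refine eventually_eq_zero_of_mul ?_ ?_
  · have h0 := han.continuousAt
    have h1 := han.deriv.continuousAt
    have h2 := han.deriv.deriv.continuousAt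
    fun_prop
  filter_upwards [eventually_hasSum_theta zero_le_one one_pos (norm_hypCoeff_le ha hb)]
    with w ⟨h0, h1, h2⟩
  have hA := h2
  have hB := (((h2.add (h1.mul_left (a + b))).add (h0.mul_left (a * b)))).mul_left w
  rw [← hasSum_nat_add_iff' 1] at hA
  have hE := eq_zero_of_hasSum (hA.sub hB) fun n => by
    push_cast
    linear_combination w ^ (n + 1) * hypCoeff_succ a b n
  simp only [Finset.sum_range_one] at hE
  push_cast at hE
  rw [hyp_eq_seriesFun]
  linear_combination hE

/-- A pullback of a hypergeometric function solves the differential equation if the coefficients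
match; here `α = A' / A`. -/
theorem solvesDiagODE_pullback {a b : ℂ} (ha : ‖a‖ ≤ 1) (hb : ‖b‖ ≤ 1)
    {A α α' w w' w'' κ : ℂ → ℂ} (hw0 : w 0 = 0)
    (hA : ∀ᶠ z in 𝓝 (0 : ℂ), HasDerivAt A (α z * A z) z)
    (hα : ∀ᶠ z in 𝓝 (0 : ℂ), HasDerivAt α (α' z) z)
    (hw : ∀ᶠ z in 𝓝 (0 : ℂ), HasDerivAt w (w' z) z)
    (hw' : ∀ᶠ z in 𝓝 (0 : ℂ), HasDerivAt w' (w'' z) z)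
    (h2 : ∀ᶠ z in 𝓝 (0 : ℂ), z * (1 - 16 * z) * (3 - 64 * z) * w' z ^ 2
      = κ z * (w z * (1 - w z)))
    (h1 : ∀ᶠ z in 𝓝 (0 : ℂ), z * (1 - 16 * z) * (3 - 64 * z) * (2 * α z * w' z + w'' z)
      + (3 - 224 * z + 3072 * z ^ 2) * w' z = κ z * (1 - (1 + a + b) * w z))
    (h0 : ∀ᶠ z in 𝓝 (0 : ℂ), z * (1 - 16 * z) * (3 - 64 * z) * (α z ^ 2 + α' z)
      + (3 - 224 * z + 3072 * z ^ 2) * α z + (960 * z - 36) = -(κ z * (a * b))) :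
    AnalyticAt ℂ (fun z => A z * ₂F₁ a b (1 : ℂ) (w z)) 0 ∧
      SolvesDiagODE fun z => A z * ₂F₁ a b (1 : ℂ) (w z) := by
  have hF := analyticAt_hyp ha hb
  have hanA : AnalyticAt ℂ A 0 := Complex.analyticAt_iff_eventually_differentiableAt.mpr
    (hA.mono fun z h => h.differentiableAt)
  have hanw : AnalyticAt ℂ w 0 := Complex.analyticAt_iff_eventually_differentiableAt.mpr
    (hw.mono fun z h => h.differentiableAt)
  have htend : Tendsto w (𝓝 0) (𝓝 0) := by
    have := hanw.continuousAt.tendsto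
    rwa [hw0] at this
  refine ⟨hanA.fun_mul (hF.fun_comp_of_eq hanw hw0), ?_⟩
  have e0 := htend.eventually hF.eventually_analyticAt
  have e1 := htend.eventually hF.deriv.eventually_analyticAt
  have ed : ∀ᶠ z in 𝓝 (0 : ℂ), deriv (fun z => A z * ₂F₁ a b (1 : ℂ) (w z)) z
      = A z * (α z * ₂F₁ a b (1 : ℂ) (w z) + w' z * deriv (₂F₁ a b (1 : ℂ)) (w z)) := by
    filter_upwards [hA, hw, e0] with z hAz hwz hFz
    have := hAz.fun_mul (hFz.differentiableAt.hasDerivAt.comp z hwz)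
    simp only [Function.comp_def] at this
    rw [this.deriv]
    ring
  filter_upwards [ed, ed.eventually_nhds, hA, hα, hw, hw', h2, h1, h0, e0, e1,
    htend.eventually (hyp_ode ha hb)] with z edz edn hAz hαz hwz hw'z h2z h1z h0z e0z e1z hode
  have edn' : deriv (fun z => A z * ₂F₁ a b (1 : ℂ) (w z)) =ᶠ[𝓝 z] fun z =>
    A z * (α z * ₂F₁ a b (1 : ℂ) (w z) + w' z * deriv (₂F₁ a b (1 : ℂ)) (w z)) := edn
  have hd := hAz.fun_mul ((hαz.fun_mul (e0z.differentiableAt.hasDerivAt.comp z hwz)).fun_add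
    (hw'z.fun_mul (e1z.differentiableAt.hasDerivAt.comp z hwz)))
  simp only [Function.comp_def] at hd
  rw [edn'.deriv_eq, edz, hd.deriv]
  -- The hypotheses `h2`, `h1`, `h0` match the coefficients of `F''`, `F'` and `F` at `w z` with `κ`
  -- times Gauss's equation.
  linear_combination A z * deriv (deriv (₂F₁ a b (1 : ℂ))) (w z) * h2z
    + A z * deriv (₂F₁ a b (1 : ℂ)) (w z) * h1z + A z * ₂F₁ a b (1 : ℂ) (w z) * h0z
    + A z * κ z * hode

theorem eventually_ne_zero_of_continuous {f : ℂ → ℂ} (hf : Continuous f) (h0 : f 0 ≠ 0) :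
    ∀ᶠ z in 𝓝 (0 : ℂ), f z ≠ 0 := hf.continuousAt.eventually_ne h0

theorem hasDerivAt_one_div_cpow {D : ℂ → ℂ} {d z : ℂ} (e : ℂ) (hD : HasDerivAt D d z)
    (hz : D z ∈ Complex.slitPlane) :
    HasDerivAt (fun z => 1 / D z ^ e) (-(e * d / D z) * (1 / D z ^ e)) z := by
  have hne := Complex.slitPlane_ne_zero hz
  have hpne : D z ^ e ≠ 0 := by simp [Complex.cpow_eq_zero_iff, hne]
  have h := (hD.cpow_const (c := e) hz).fun_inv hpne
  simp only [one_div]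
  refine h.congr_deriv ?_
  rw [Complex.cpow_sub _ _ hne, Complex.cpow_one]
  field_simp

/-- Here `1 - w = (1 - 16 z)³ / (1 - 24 z)²`, so `w'` and the multiplier `κ`, which is forced by the
`F''` coefficient, factor completely. -/
theorem diagFun_eq_quarter :
    ∀ᶠ z in 𝓝 (0 : ℂ), diagFun z = 1 / (1 - 24 * z) ^ (1 / 2 : ℂ) *
      ₂F₁ (1 / 4 : ℂ) (3 / 4 : ℂ) (1 : ℂ) (-64 * z ^ 2 * (3 - 64 * z) / (1 - 24 * z) ^ 2) := by
  have hD : ∀ᶠ z in 𝓝 (0 : ℂ), 1 - 24 * z ≠ 0 :=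
    eventually_ne_zero_of_continuous (by fun_prop) (by norm_num)
  have hs : ∀ᶠ z in 𝓝 (0 : ℂ), 1 - 24 * z ∈ Complex.slitPlane := by
    have hc : ContinuousAt (fun z : ℂ => 1 - 24 * z) 0 := by fun_prop
    exact hc.eventually (Complex.isOpen_slitPlane.mem_nhds (by simp))
  have hd : ∀ z : ℂ, HasDerivAt (fun z : ℂ => 1 - 24 * z) (-24) z := fun z => by
    simpa using ((hasDerivAt_id z).const_mul 24).const_sub 1
  have key := solvesDiagODE_pullback (a := 1 / 4) (b := 3 / 4) (by norm_num) (by norm_num)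
    (A := fun z => 1 / (1 - 24 * z) ^ (1 / 2 : ℂ)) (α := fun z => 12 / (1 - 24 * z))
    (α' := fun z => 288 / (1 - 24 * z) ^ 2)
    (w := fun z => -64 * z ^ 2 * (3 - 64 * z) / (1 - 24 * z) ^ 2)
    (w' := fun z => -384 * z * (1 - 16 * z) ^ 2 / (1 - 24 * z) ^ 3)
    (w'' := fun z => -384 * ((1 - 64 * z + 768 * z ^ 2) * (1 - 24 * z)
      + 72 * (z * (1 - 16 * z) ^ 2)) / (1 - 24 * z) ^ 4)
    (κ := fun z => -2304 * z * (1 - 16 * z) ^ 2 / (1 - 24 * z) ^ 2) (by simp)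
    (by
      filter_upwards [hs] with z hz
      refine (hasDerivAt_one_div_cpow (1 / 2) (hd z) hz).congr_deriv ?_
      ring)
    (by
      filter_upwards [hD] with z hz
      refine ((hasDerivAt_const z (12 : ℂ)).fun_div (hd z) hz).congr_deriv ?_
      ring)
    (by
      filter_upwards [hD] with z hz
      have hn : HasDerivAt (fun z : ℂ => -64 * z ^ 2 * (3 - 64 * z)) (-384 * z + 12288 * z ^ 2) z := by
        have := ((hasDerivAt_pow 2 z).const_mul (-64)).fun_mul
          (((hasDerivAt_id z).const_mul 64).const_sub 3)
        simp only [id] at this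
        refine this.congr_deriv ?_
        push_cast
        ring
      refine (hn.fun_div ((hd z).fun_pow 2) (pow_ne_zero 2 hz)).congr_deriv ?_
      -- The denominator is kept as an atom while fractions are cleared, then expanded for the
      -- polynomial identity.
      obtain ⟨D, e⟩ : ∃ D, D = 1 - 24 * z := ⟨_, rfl⟩
      simp only [← e] at hz ⊢
      field_simp
      rw [e]
      push_cast
      ring)
    (by
      filter_upwards [hD] with z hz
      have hn : HasDerivAt (fun z : ℂ => -384 * z * (1 - 16 * z) ^ 2)
          (-384 * (1 - 64 * z + 768 * z ^ 2)) z := by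
        have := ((hasDerivAt_id z).const_mul (-384)).fun_mul
          ((((hasDerivAt_id z).const_mul 16).const_sub 1).fun_pow 2)
        simp only [id] at this
        refine this.congr_deriv ?_
        push_cast
        ring
      refine (hn.fun_div ((hd z).fun_pow 3) (pow_ne_zero 3 hz)).congr_deriv ?_
      obtain ⟨D, e⟩ : ∃ D, D = 1 - 24 * z := ⟨_, rfl⟩
      simp only [← e] at hz ⊢
      field_simp
      rw [e]
      push_cast
      ring)
    (by
      filter_upwards [hD] with z hz
      obtain ⟨D, e⟩ : ∃ D, D = 1 - 24 * z := ⟨_, rfl⟩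
      simp only [← e] at hz ⊢
      field_simp
      rw [e]
      ring)
    (by
      filter_upwards [hD] with z hz
      obtain ⟨D, e⟩ : ∃ D, D = 1 - 24 * z := ⟨_, rfl⟩
      simp only [← e] at hz ⊢
      field_simp
      rw [e]
      ring)
    (by
      filter_upwards [hD] with z hz
      obtain ⟨D, e⟩ : ∃ D, D = 1 - 24 * z := ⟨_, rfl⟩
      simp only [← e] at hz ⊢
      field_simp
      rw [e]
      ring)
  exact solvesDiagODE_diagFun.unique analyticAt_diagFun key.1 (by simp [diagFun_zero]) key.2

/-- With `D = 1 - 48 z + 12288 z³`, one has `1 - w = ((1 - 24 z)(1 - 48 z + 2304 z² - 36864 z³))² /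
D³`. This square root of the numerator is the unusual factor in `w'`, and it cancels from `κ`. -/
theorem diagFun_eq_twelfth :
    ∀ᶠ z in 𝓝 (0 : ℂ), diagFun z = 1 / (1 - 48 * z + 12288 * z ^ 3) ^ (1 / 4 : ℂ) *
      ₂F₁ (1 / 12 : ℂ) (5 / 12 : ℂ) (1 : ℂ)
        (-1728 * z ^ 2 * (3 - 64 * z) * (1 - 16 * z) ^ 6 /
          (1 - 48 * z + 12288 * z ^ 3) ^ 3) := by
  have hD : ∀ᶠ z in 𝓝 (0 : ℂ), 1 - 48 * z + 12288 * z ^ 3 ≠ 0 :=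
    eventually_ne_zero_of_continuous (by fun_prop) (by norm_num)
  have hs : ∀ᶠ z in 𝓝 (0 : ℂ), 1 - 48 * z + 12288 * z ^ 3 ∈ Complex.slitPlane := by
    have hc : ContinuousAt (fun z : ℂ => 1 - 48 * z + 12288 * z ^ 3) 0 := by fun_prop
    exact hc.eventually (Complex.isOpen_slitPlane.mem_nhds (by simp))
  have hd : ∀ z : ℂ, HasDerivAt (fun z : ℂ => 1 - 48 * z + 12288 * z ^ 3)
      (-48 + 36864 * z ^ 2) z := fun z => by
    have := (((hasDerivAt_id z).const_mul 48).const_sub 1).fun_add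
      ((hasDerivAt_pow 3 z).const_mul 12288)
    simp only [id] at this
    refine this.congr_deriv ?_
    push_cast
    ring
  have hl : ∀ (s t : ℂ) (z : ℂ), HasDerivAt (fun z : ℂ => s - t * z) (-t) z := fun s t z => by
    simpa using ((hasDerivAt_id z).const_mul t).const_sub s
  have key := solvesDiagODE_pullback (a := 1 / 12) (b := 5 / 12) (by norm_num) (by norm_num)
    (A := fun z => 1 / (1 - 48 * z + 12288 * z ^ 3) ^ (1 / 4 : ℂ))
    (α := fun z => (12 - 9216 * z ^ 2) / (1 - 48 * z + 12288 * z ^ 3))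
    (α' := fun z => (-18432 * z * (1 - 48 * z + 12288 * z ^ 3)
      - (12 - 9216 * z ^ 2) * (-48 + 36864 * z ^ 2)) / (1 - 48 * z + 12288 * z ^ 3) ^ 2)
    (w := fun z => -1728 * z ^ 2 * (3 - 64 * z) * (1 - 16 * z) ^ 6
      / (1 - 48 * z + 12288 * z ^ 3) ^ 3)
    (w' := fun z => -10368 * z * (1 - 16 * z) ^ 5 * ((1 - 24 * z)
      * (1 - 48 * z + 2304 * z ^ 2 - 36864 * z ^ 3)) / (1 - 48 * z + 12288 * z ^ 3) ^ 4)
    (w'' := fun z => -10368 * (1 - 16 * z) ^ 4 *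
      (((1 - 96 * z) * ((1 - 24 * z) * (1 - 48 * z + 2304 * z ^ 2 - 36864 * z ^ 3))
        + z * (1 - 16 * z) * (-24 * (1 - 48 * z + 2304 * z ^ 2 - 36864 * z ^ 3)
          + (1 - 24 * z) * (-48 + 4608 * z - 110592 * z ^ 2))) * (1 - 48 * z + 12288 * z ^ 3)
      - 4 * (z * (1 - 16 * z) * ((1 - 24 * z) * (1 - 48 * z + 2304 * z ^ 2 - 36864 * z ^ 3)))
        * (-48 + 36864 * z ^ 2)) / (1 - 48 * z + 12288 * z ^ 3) ^ 5)
    (κ := fun z => -62208 * z * (1 - 16 * z) ^ 5 / (1 - 48 * z + 12288 * z ^ 3) ^ 2) (by simp)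
    (by
      filter_upwards [hs] with z hz
      refine (hasDerivAt_one_div_cpow (1 / 4) (hd z) hz).congr_deriv ?_
      ring)
    (by
      filter_upwards [hD] with z hz
      have hn : HasDerivAt (fun z : ℂ => 12 - 9216 * z ^ 2) (-18432 * z) z := by
        refine (((hasDerivAt_pow 2 z).const_mul 9216).const_sub 12).congr_deriv ?_
        push_cast
        ring
      exact hn.fun_div (hd z) hz)
    (by
      filter_upwards [hD] with z hz
      have hn := (((hasDerivAt_pow 2 z).const_mul (-1728)).fun_mul (hl 3 64 z)).fun_mul
        ((hl 1 16 z).fun_pow 6)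
      refine (hn.fun_div ((hd z).fun_pow 3) (pow_ne_zero 3 hz)).congr_deriv ?_
      obtain ⟨D, e⟩ : ∃ D, D = 1 - 48 * z + 12288 * z ^ 3 := ⟨_, rfl⟩
      simp only [← e] at hz ⊢
      field_simp
      rw [e]
      push_cast
      ring)
    (by
      filter_upwards [hD] with z hz
      have hr : HasDerivAt (fun z : ℂ => 1 - 48 * z + 2304 * z ^ 2 - 36864 * z ^ 3)
          (-48 + 4608 * z - 110592 * z ^ 2) z := by
        refine (((hl 1 48 z).fun_add ((hasDerivAt_pow 2 z).const_mul 2304)).fun_sub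
          ((hasDerivAt_pow 3 z).const_mul 36864)).congr_deriv ?_
        push_cast
        ring
      have hn := (((hasDerivAt_id z).const_mul (-10368)).fun_mul ((hl 1 16 z).fun_pow 5)).fun_mul
        ((hl 1 24 z).fun_mul hr)
      simp only [id] at hn
      refine (hn.fun_div ((hd z).fun_pow 4) (pow_ne_zero 4 hz)).congr_deriv ?_
      obtain ⟨D, e⟩ : ∃ D, D = 1 - 48 * z + 12288 * z ^ 3 := ⟨_, rfl⟩
      simp only [← e] at hz ⊢
      field_simp
      rw [e]
      push_cast
      ring)
    (by
      filter_upwards [hD] with z hz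
      obtain ⟨D, e⟩ : ∃ D, D = 1 - 48 * z + 12288 * z ^ 3 := ⟨_, rfl⟩
      simp only [← e] at hz ⊢
      field_simp
      rw [e]
      ring)
    (by
      filter_upwards [hD] with z hz
      obtain ⟨D, e⟩ : ∃ D, D = 1 - 48 * z + 12288 * z ^ 3 := ⟨_, rfl⟩
      simp only [← e] at hz ⊢
      field_simp
      rw [e]
      ring)
    (by
      filter_upwards [hD] with z hz
      obtain ⟨D, e⟩ : ∃ D, D = 1 - 48 * z + 12288 * z ^ 3 := ⟨_, rfl⟩
      simp only [← e] at hz ⊢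
      field_simp
      rw [e]
      ring)
  exact solvesDiagODE_diagFun.unique analyticAt_diagFun key.1 (by simp [diagFun_zero]) key.2

/-! ### Assembly of the statement. -/

theorem mainTheorem6 :
    ∃ u : ℕ → ℚ,
      -- the scaled diagonal coefficients, their initial values and their factorization
      (scaledDiag 0 = 1 ∧ scaledDiag 1 = 24 ∧ scaledDiag 2 = 1080 ∧ scaledDiag 3 = 58560 ∧
        scaledDiag 4 = 3490200 ∧ scaledDiag 5 = 220739904) ∧
      (∀ n : ℕ, scaledDiag n = (Nat.choose (2 * n) n : ℚ) * u n) ∧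
      -- the three-term recurrence for `n ≥ 0`, with `u_{-1} = 0`
      3 * u 1 = 4 * 9 * u 0 ∧
      (∀ n : ℕ, 1 ≤ n →
        3 * ((n : ℚ) + 1) ^ 2 * u (n + 1)
          = 4 * (28 * (n : ℚ) ^ 2 + 28 * (n : ℚ) + 9) * u n
            - 64 * (4 * (n : ℚ) - 1) * (4 * (n : ℚ) + 1) * u (n - 1)) ∧
      -- the generating function
      (∃ y₀ : ℂ → ℂ,
        (∀ᶠ z in 𝓝 (0 : ℂ), HasSum (fun n : ℕ => (u n : ℂ) * z ^ n) (y₀ z)) ∧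
        -- it is the unique analytic solution of the differential equation with value 1 at 0
        (AnalyticAt ℂ y₀ 0 ∧ y₀ 0 = 1 ∧ SolvesDiagODE y₀) ∧
        (∀ g : ℂ → ℂ, AnalyticAt ℂ g 0 → g 0 = 1 → SolvesDiagODE g → g =ᶠ[𝓝 0] y₀) ∧
        -- the first hypergeometric representation
        (∀ᶠ z in 𝓝 (0 : ℂ),
          y₀ z = 1 / (1 - 48 * z + 12288 * z ^ 3) ^ (1 / 4 : ℂ) *
            ₂F₁ (1 / 12 : ℂ) (5 / 12 : ℂ) (1 : ℂ)
              (-1728 * z ^ 2 * (3 - 64 * z) * (1 - 16 * z) ^ 6 /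
                (1 - 48 * z + 12288 * z ^ 3) ^ 3)) ∧
        -- the simplified hypergeometric representation
        (∀ᶠ z in 𝓝 (0 : ℂ),
          y₀ z = 1 / (1 - 24 * z) ^ (1 / 2 : ℂ) *
            ₂F₁ (1 / 4 : ℂ) (3 / 4 : ℂ) (1 : ℂ)
              (-64 * z ^ 2 * (3 - 64 * z) / (1 - 24 * z) ^ 2))) ∧
      -- positivity
      (∀ n : ℕ, 0 < u n) ∧
      (∀ n : ℕ, 0 < scaledDiag n) := by

  obtain ⟨v0, v1, v2, v3, v4, v5⟩ := diagQuot_values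
  refine ⟨diagQuot, ?_, scaledDiag_eq, ?_, ?_, ⟨diagFun, ?_, ⟨analyticAt_diagFun, diagFun_zero,
    solvesDiagODE_diagFun⟩, ?_, diagFun_eq_twelfth, diagFun_eq_quarter⟩, diagQuot_pos, ?_⟩
  · simp only [scaledDiag_eq, v0, v1, v2, v3, v4, v5]
    norm_num [Nat.choose]
  · rw [v0, v1]
    norm_num
  · intro n hn
    obtain ⟨m, rfl⟩ := Nat.exists_eq_add_of_le' hn
    rw [Nat.add_sub_cancel]
    push_cast
    linear_combination diagQuot_rec m
  · exact (eventually_hasSum_theta zero_le_one (by norm_num) norm_diagQuot_le).mono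
      fun z h => h.1
  · intro g hg hg0 hode
    exact hode.unique hg analyticAt_diagFun (hg0.trans diagFun_zero.symm) solvesDiagODE_diagFun
  · intro n
    rw [scaledDiag_eq]
    exact mul_pos (by exact_mod_cast Nat.choose_pos (by omega)) (diagQuot_pos n)
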